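/- Let $F$ be an NFT-field, that is, a field such that the torsion subgroup of its multiplicative group $F^\times$ is finite. Let $n\ge 1$, and let $T_n(F)$ be the group of invertible upper triangular $n\times n$ matrices over $F$ and $UT_n(F)$ its subgroup of unitriangular matrices. Let $B_n(F)\cong (F^\times)^{n-1}$ be the group of invertible diagonal $n\times n$ matrices over $F$ whose last diagonal entry is $1$. Let $Z$ be an abelian group (written multiplicatively) that is elementarily equivalent to $F^\times$ in the language of groups. For an abelian group $A$, let $S^2(A,Z)$ be the group of symmetric 2-cocycles, that is, of functions $f:A\times A\to Z$ with $f(xy,z)f(x,y)=f(x,yz)f(y,z)$, $f(1,x)=f(x,1)=1$ and $f(x,y)=f(y,x)$. Such an $f$ is a 2-coboundary if there is a function $\psi:A\to Z$ with $\psi(xy)=f(x,y)\psi(x)\psi(y)$ for all $x,y\in A$, and two cocycles are cohomologous if their quotient is a 2-coboundary. Suppose that $A=T\times B$, where $T$ is the torsion subgroup of $A$. Then $f\in S^2(A,Z)$ is called a coboundary on torsion (CoT) if it is cohomologous to a cocycle of the form $(tb,t'b')\mapsto f_1(t,t')f_2(b,b')$ with $f_1\in S^2(T,Z)$ and $f_2\in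 S^2(B,Z)$, where $f_1$ is a 2-coboundary. For $f\in S^2(B_n(F),Z)$ let $D_n(F,f,Z)$ be the abelian group with underlying set $Z\times B_n(F)$ and multiplication $(z_1,b_1)(z_2,b_2)=(z_1z_2f(b_1,b_2),b_1b_2)$, and let $T_n(F,f,Z)=UT_n(F)\rtimes D_n(F,f,Z)$, where $(z,b)$ acts on $UT_n(F)$ by $u\mapsto bub^{-1}$. If $f\in S^2(B_n(F),Z)$ is CoT, then $T_n(F,f,Z)\equiv T_n(F)$, that is, the two groups satisfy the same first-order sentences of the language of groups. -/

import Mathlib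

open FirstOrder

universe u v

/-! ### Groups as first-order structures -/

/-- The function symbols of the language of groups: `1`, `x⁻¹` and `x * y`. -/
inductive GroupFunc : ℕ → Type
  | one : GroupFunc 0
  | inv : GroupFunc 1
  | mul : GroupFunc 2

/-- The first-order language of groups. -/
def groupLang : FirstOrder.Language.{0, 0} := ⟨GroupFunc, fun _ => Empty⟩

/-- Every group, as a structure in the language of groups. -/
instance groupLangStructure (G : Type u) [Group G] : groupLang.Structure G where
  funMap := fun {_} s x =>
    match s, x with
    | GroupFunc.one, _ => 1
    | GroupFunc.inv, x => (x 0)⁻¹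
    | GroupFunc.mul, x => x 0 * x 1
  RelMap := fun {_} r _ => Empty.elim r

/-! ### Symmetric 2-cocycles and abelian extensions -/

section Cocycles

variable (A : Type u) (Z : Type v) [CommGroup A] [CommGroup Z]

/-- The group `S²(A, Z)` of (normalized) symmetric 2-cocycles, for the trivial action of `A` on
`Z`. The group operation is the pointwise multiplication. -/
def symmCocycles : Subgroup (A → A → Z) where
  carrier := {f | (∀ x y z, f (x * y) z * f x y = f x (y * z) * f y z) ∧
    (∀ x, f 1 x = 1 ∧ f x 1 = 1) ∧ ∀ x y, f x y = f y x}
  one_mem' := by simp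
  mul_mem' := by
    rintro f g ⟨hf, hf1, hfs⟩ ⟨hg, hg1, hgs⟩
    refine ⟨fun x y z => ?_, fun x => ?_, fun x y => ?_⟩
    · simp only [Pi.mul_apply]
      rw [mul_mul_mul_comm, hf, hg, mul_mul_mul_comm]
    · simp [hf1, hg1]
    · simp [hfs x y, hgs x y]
  inv_mem' := by
    rintro f ⟨hf, hf1, hfs⟩
    refine ⟨fun x y z => ?_, fun x => ?_, fun x y => ?_⟩
    · simp only [Pi.inv_apply]
      rw [← mul_inv, hf, mul_inv]
    · simp [hf1]
    · simp [hfs x y]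

variable {A Z}

/-- `g` is a 2-coboundary: `ψ (x * y) = g x y * ψ x * ψ y` for some function `ψ : A → Z`. -/
def IsCoboundary (g : A → A → Z) : Prop :=
  ∃ ψ : A → Z, ∀ x y, ψ (x * y) = g x y * ψ x * ψ y

/-- `f` and `g` are cohomologous: they differ by a 2-coboundary. -/
def Cohomologous (f g : A → A → Z) : Prop :=
  IsCoboundary (f * g⁻¹)

/-- The symmetric 2-cocycle `f` on `A` is a *coboundary on torsion* (CoT): for a decomposition
`A = T × B` of `A`, where `T` is the torsion subgroup, `f` is cohomologous to the product `f₁ · f₂`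
of some `f₁ ∈ S²(T, Z)` and `f₂ ∈ S²(B, Z)` (as a cocycle on `T × B`), where `f₁` is a
2-coboundary. -/
def IsCoT (f : symmCocycles A Z) : Prop :=
  ∃ B : Subgroup A, IsCompl (CommGroup.torsion A) B ∧
    ∃ (f₁ : symmCocycles (CommGroup.torsion A) Z) (f₂ : symmCocycles B Z) (g : symmCocycles A Z),
      (∀ (t t' : CommGroup.torsion A) (b b' : B),
        g.1 (t * b) (t' * b') = f₁.1 t t' * f₂.1 b b') ∧
      Cohomologous f.1 g.1 ∧ IsCoboundary f₁.1

/-- The abelian extension of `Z` by `A` given by a symmetric 2-cocycle `f`: the set `Z × A` with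
the multiplication `(z₁, b₁) (z₂, b₂) = (z₁ z₂ f(b₁, b₂), b₁ b₂)`. -/
@[ext]
structure AbExt (f : symmCocycles A Z) where
  z : Z
  b : A

namespace AbExt

variable (f : symmCocycles A Z)

instance : Mul (AbExt f) := ⟨fun x y => ⟨x.z * y.z * f.1 x.b y.b, x.b * y.b⟩⟩

instance : One (AbExt f) := ⟨⟨1, 1⟩⟩

instance : Inv (AbExt f) := ⟨fun x => ⟨x.z⁻¹ * (f.1 x.b⁻¹ x.b)⁻¹, x.b⁻¹⟩⟩

@[simp] theorem mul_z (x y : AbExt f) : (x * y).z = x.z * y.z * f.1 x.b y.b := rfl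

@[simp] theorem mul_b (x y : AbExt f) : (x * y).b = x.b * y.b := rfl

@[simp] theorem one_z : (1 : AbExt f).z = 1 := rfl

@[simp] theorem one_b : (1 : AbExt f).b = 1 := rfl

@[simp] theorem inv_z (x : AbExt f) : (x⁻¹).z = x.z⁻¹ * (f.1 x.b⁻¹ x.b)⁻¹ := rfl

@[simp] theorem inv_b (x : AbExt f) : (x⁻¹).b = x.b⁻¹ := rfl

instance : CommGroup (AbExt f) where
  mul_assoc x y w := by
    ext
    · have h := f.2.1 x.b y.b w.b
      simp only [mul_z, mul_b]
      calc x.z * y.z * f.1 x.b y.b * w.z * f.1 (x.b * y.b) w.b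
          = x.z * y.z * w.z * (f.1 (x.b * y.b) w.b * f.1 x.b y.b) := by
            ac_rfl
        _ = x.z * (y.z * w.z * f.1 y.b w.b) * f.1 x.b (y.b * w.b) := by
            rw [h]; ac_rfl
    · simp [mul_assoc]
  one_mul x := by
    ext
    · simp [(f.2.2.1 x.b).1]
    · simp
  mul_one x := by
    ext
    · simp [(f.2.2.1 x.b).2]
    · simp
  inv_mul_cancel x := by
    ext
    · simp only [mul_z, inv_z, inv_b, one_z]
      rw [mul_right_comm x.z⁻¹, inv_mul_cancel, one_mul, inv_mul_cancel]
    · simp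
  mul_comm x y := by
    ext
    · simp only [mul_z]
      rw [f.2.2.2 x.b y.b, mul_comm x.z]
    · simp [mul_comm]

/-- The projection of the extension onto its quotient `A` by the subgroup `Z`. -/
def proj : AbExt f →* A where
  toFun := b
  map_one' := rfl
  map_mul' _ _ := rfl

end AbExt

end Cocycles

/-! ### Triangular groups and their abelian deformations -/

section Triangular

variable (n : ℕ) (F : Type u) [Field F]

/-- `F` is an NFT-field (a field of number field type): the torsion subgroup of its multiplicative
group is finite. -/
def IsNFTField : Prop := Finite (CommGroup.torsion Fˣ)

/-- `T_n(F)`: the group of invertible upper triangular `n × n` matrices. -/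
def triGroup : Subgroup (GL (Fin n) F) where
  carrier := {g | (g : Matrix (Fin n) (Fin n) F).IsUpperTriangular}
  one_mem' := by
    simpa using Matrix.blockTriangular_one (R := F) (b := (id : Fin n → Fin n))
  mul_mem' := by
    intro a b ha hb
    simpa using Matrix.BlockTriangular.mul ha hb
  inv_mem' := by
    intro a ha
    have : Invertible (a : Matrix (Fin n) (Fin n) F) := a.invertible
    simpa using Matrix.blockTriangular_inv_of_blockTriangular ha

/-- The homomorphism sending a matrix in `T_n(F)` to its diagonal `(g_{11}, …, g_{nn})`. -/
def diagEntries : triGroup n F →* (Fin n → F) where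
  toFun g i := (g : GL (Fin n) F) i i
  map_one' := by
    funext i
    simp
  map_mul' := by
    intro a b
    funext i
    have ha : ∀ i j, j < i → (a : GL (Fin n) F) i j = 0 := fun i j h => a.2 h
    have hb : ∀ i j, j < i → (b : GL (Fin n) F) i j = 0 := fun i j h => b.2 h
    simp only [Subgroup.coe_mul, Units.val_mul, Pi.mul_apply, Matrix.mul_apply]
    refine Finset.sum_eq_single i (fun j _ hj => ?_) (by simp)
    rcases lt_or_gt_of_ne hj with h | h
    · rw [ha i j h, zero_mul]
    · rw [hb j i h, mul_zero]

/-- `UT_n(F)`: the (normal) subgroup of `T_n(F)` of all upper unitriangular matrices, that is, those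
all of whose diagonal entries are `1`. -/
def uniTri : Subgroup (triGroup n F) := (diagEntries n F).ker

instance uniTri_normal : (uniTri n F).Normal :=
  inferInstanceAs (diagEntries n F).ker.Normal

/-- The embedding of `(F^×)^n` into `T_n(F)` as the torus `D_n(F)` of diagonal matrices. -/
def diagHom : (Fin n → Fˣ) →* triGroup n F :=
  (((Units.map (Matrix.diagonalRingHom (Fin n) F).toMonoidHom).comp
    MulEquiv.piUnits.symm.toMonoidHom).codRestrict (triGroup n F) (by
      intro d
      exact Matrix.blockTriangular_diagonal _))

/-- The subgroup `B_n(F) = ∏_{i=1}^{n-1} d_i(F^×)` of the torus `D_n(F) = (F^×)^n`: the last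
diagonal entry is `1`. It is a complement of the subgroup of scalar matrices. -/
def torusB : Subgroup (Fin n → Fˣ) where
  carrier := {d | ∀ i : Fin n, (i : ℕ) + 1 = n → d i = 1}
  one_mem' := by simp
  mul_mem' := by
    intro a b ha hb i hi
    simp [ha i hi, hb i hi]
  inv_mem' := by
    intro a ha i hi
    simp [ha i hi]

/-- The action of `B_n(F)` on `UT_n(F)` by conjugation, `u ↦ b u b⁻¹`. -/
def torusAct : torusB n F →* MulAut (uniTri n F) :=
  (MulAut.conjNormal (H := uniTri n F)).comp ((diagHom n F).comp (torusB n F).subtype)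

variable (Z : Type v) [CommGroup Z]

/-- The abelian deformation `T_n(F, f, Z) = UT_n(F) ⋊ D_n(F, f, Z)` of `T_n(F)`, where
`D_n(F, f, Z)` is the abelian extension of `Z` by `B_n(F)` given by `f`, acting on `UT_n(F)`
through its quotient `B_n(F)`. -/
abbrev AbDeformation (f : symmCocycles (torusB n F) Z) : Type (max u v) :=
  uniTri n F ⋊[(torusAct n F).comp (AbExt.proj f)] AbExt f

end Triangular

/-! Write `Tₙ(F) ≅ (UTₙ ⋊ Bₙ) × Fˣ`, the second factor being the scalar matrices. The deformation is
an extension of `UTₙ ⋊ Bₙ` by `Z`, and the point is that it becomes a direct product in an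
ultrapower over `ℕ`. Elementary equivalence is preserved by binary products (Feferman–Vaught), so
`Z` may then be replaced by `Fˣ`. The splitting is homological. An ultrapower `W` of an abelian
group solves all systems `z k = (k + 1) • z (k + 1) + c k` (`exists_germ_eq_pow_mul`). This gives
`Ext(ℚ, W) = 0`, hence `Ext(B, W) = 0` for every torsion-free `B`
(`exists_retraction_of_torsionFree_quotient`). CoT splits the extension over the torsion subgroup
`T`, so `Z × T` embeds in it with torsion-free quotient, and the ultrapower retracts onto that of
`Z`. -/

section ModelTheory

/-! ### Ultrapowers and products of groups up to elementary equivalence -/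

open FirstOrder.Language Filter

/-- A group isomorphism, as an isomorphism of structures. -/
def MulEquiv.toGroupLangEquiv {G : Type*} {H : Type*} [Group G] [Group H] (e : G ≃* H) :
    G ≃[groupLang] H where
  toEquiv := e.toEquiv
  map_fun' := by
    intro n s x
    cases s
    · exact map_one e
    · exact map_inv e _
    · exact map_mul e _ _
  map_rel' := by
    intro n r
    exact Empty.elim r

/-- A group homomorphism, as a homomorphism of structures. -/
def MonoidHom.toGroupLangHom {G : Type*} {H : Type*} [Group G] [Group H] (e : G →* H) :
    G →[groupLang] H where
  toFun := e
  map_fun' := by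
    intro n s x
    cases s
    · exact map_one e
    · exact map_inv e _
    · exact map_mul e _ _
  map_rel' := by
    intro n r
    exact Empty.elim r

theorem MulEquiv.elementarilyEquivalent {G : Type u} {H : Type v} [Group G] [Group H]
    (e : G ≃* H) : G ≅[groupLang] H :=
  StrongHomClass.elementarilyEquivalent e.toGroupLangEquiv

/-- An ultrapower of a group, constructed as a group of germs, is its ultrapower as a
structure. -/
def germEquivProduct (G : Type*) [Group G] {ι : Type*} (U : Ultrafilter ι) :
    Germ (U : Filter ι) G ≃[groupLang] (U : Filter ι).Product (fun _ => G) where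
  toEquiv := Quotient.congrRight fun _ _ => Iff.rfl
  map_fun' := by
    intro n s x
    obtain ⟨x, rfl⟩ : ∃ y : Fin n → ι → G, (fun i => (y i : Germ (U : Filter ι) G)) = x :=
      ⟨fun i => (x i).out, funext fun i => (x i).out_eq⟩
    refine Eq.trans ?_ (Ultraproduct.funMap_cast (M := fun _ => G) (u := U) s x).symm
    cases s <;> rfl
  map_rel' := by
    intro n r
    exact Empty.elim r

/-- Łoś's theorem for a constant family. -/
theorem elementarilyEquivalent_germ (G : Type*) [Group G] {ι : Type*} (U : Ultrafilter ι) :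
    G ≅[groupLang] Germ (U : Filter ι) G := by
  refine .trans ?_ (StrongHomClass.elementarilyEquivalent (germEquivProduct G U)).symm
  refine elementarilyEquivalent_iff.2 fun φ => ?_
  rw [Ultraproduct.sentence_realize, eventually_const]

namespace FirstOrder.Language.BoundedFormula

variable {L : Language} {α : Type*}

/-- For a list of pairs of formulas, representing the disjunction of the conjunctions
`φ(x) ∧ ψ(y)`, a list of pairs that represents its negation. -/
def negPairs {n : ℕ} : List (L.BoundedFormula α n × L.BoundedFormula α n) →
    List (L.BoundedFormula α n × L.BoundedFormula α n)
  | [] => [(⊤, ⊤)]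
  | p :: l => (negPairs l).flatMap fun q => [(q.1 ⊓ ∼p.1, q.2), (q.1, q.2 ⊓ ∼p.2)]

/-- The Feferman–Vaught decomposition of a formula over a binary product of structures. -/
def prodPairs : {n : ℕ} → L.BoundedFormula α n → List (L.BoundedFormula α n × L.BoundedFormula α n)
  | _, falsum => []
  | _, equal t s => [(equal t s, equal t s)]
  | _, rel R ts => [(rel R ts, rel R ts)]
  | _, imp φ ψ => negPairs φ.prodPairs ++ ψ.prodPairs
  | _, all φ => negPairs ((negPairs φ.prodPairs).map fun p => (p.1.ex, p.2.ex))

/-- To refute a disjunction of pairs is to choose, for each pair, a coordinate in which it fails. -/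
theorem exists_mem_negPairs {M N : Type*} [L.Structure M] [L.Structure N] {n : ℕ}
    (l : List (L.BoundedFormula α n × L.BoundedFormula α n))
    (v : α → M) (w : α → N) (x : Fin n → M) (y : Fin n → N) :
    (∃ p ∈ negPairs l, p.1.Realize v x ∧ p.2.Realize w y) ↔
      ¬ ∃ p ∈ l, p.1.Realize v x ∧ p.2.Realize w y := by
  induction l with
  | nil => simp [negPairs]
  | cons p l ih =>
    have : (∃ q ∈ negPairs (p :: l), q.1.Realize v x ∧ q.2.Realize w y) ↔
        (∃ q ∈ negPairs l, q.1.Realize v x ∧ q.2.Realize w y) ∧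
          ¬ (p.1.Realize v x ∧ p.2.Realize w y) := by
      simp only [negPairs, List.mem_flatMap, List.mem_cons, List.not_mem_nil, or_false]
      constructor
      · rintro ⟨q, ⟨r, hr, rfl | rfl⟩, h1, h2⟩ <;> simp only [realize_inf, realize_not] at h1 h2
        · exact ⟨⟨r, hr, h1.1, h2⟩, fun h => h1.2 h.1⟩
        · exact ⟨⟨r, hr, h1, h2.1⟩, fun h => h2.2 h.2⟩
      · rintro ⟨⟨r, hr, h1, h2⟩, h⟩
        by_cases hp : p.1.Realize v x
        · exact ⟨_, ⟨r, hr, .inr rfl⟩, h1, realize_inf.2 ⟨h2, realize_not.2 fun h' => h ⟨hp, h'⟩⟩⟩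
        · exact ⟨_, ⟨r, hr, .inl rfl⟩, realize_inf.2 ⟨h1, realize_not.2 hp⟩, h2⟩
    rw [this, ih, ← not_or]
    simp only [List.mem_cons, exists_eq_or_imp]
    rw [or_comm]

/-- Equations in a product hold coordinatewise. For `∀`, read as `¬∃¬`: `∃` commutes with
disjunctions, and a witness in `G × H` is an independent choice of two witnesses. -/
theorem realize_prod_iff {G H : Type*} [Group G] [Group H] {n : ℕ}
    (φ : groupLang.BoundedFormula α n) (v : α → G × H) (x : Fin n → G × H) :
    φ.Realize v x ↔ ∃ p ∈ φ.prodPairs, p.1.Realize (Prod.fst ∘ v) (Prod.fst ∘ x) ∧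
      p.2.Realize (Prod.snd ∘ v) (Prod.snd ∘ x) := by
  induction φ with
  | falsum => simp [prodPairs, Realize]
  | equal t s =>
    have h1 (t : groupLang.Term (α ⊕ Fin _)) : t.realize (Prod.fst ∘ Sum.elim v x) =
        (t.realize (Sum.elim v x)).1 :=
      HomClass.realize_term (MonoidHom.fst G H).toGroupLangHom
    have h2 (t : groupLang.Term (α ⊕ Fin _)) : t.realize (Prod.snd ∘ Sum.elim v x) =
        (t.realize (Sum.elim v x)).2 :=
      HomClass.realize_term (MonoidHom.snd G H).toGroupLangHom
    simp only [prodPairs, List.mem_singleton, exists_eq_left, Realize, ← Sum.comp_elim, h1, h2]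
    exact Prod.ext_iff
  | rel R ts => exact Empty.elim R
  | imp φ ψ ih1 ih2 =>
    simp only [prodPairs, List.mem_append, or_and_right, exists_or, exists_mem_negPairs,
      realize_imp, ih1, ih2]
    exact imp_iff_not_or
  | all φ ih =>
    rw [prodPairs, exists_mem_negPairs, realize_all, ← not_exists_not]
    refine not_congr ⟨?_, ?_⟩
    · rintro ⟨a, ha⟩
      rw [ih, ← exists_mem_negPairs, Fin.comp_snoc, Fin.comp_snoc] at ha
      obtain ⟨p, hp, h1, h2⟩ := ha
      exact ⟨_, List.mem_map_of_mem hp, realize_ex.2 ⟨_, h1⟩, realize_ex.2 ⟨_, h2⟩⟩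
    · rintro ⟨q, hq, h1, h2⟩
      obtain ⟨p, hp, rfl⟩ := List.mem_map.1 hq
      obtain ⟨a, ha⟩ := realize_ex.1 h1
      obtain ⟨b, hb⟩ := realize_ex.1 h2
      refine ⟨(a, b), ?_⟩
      rw [ih, ← exists_mem_negPairs, Fin.comp_snoc, Fin.comp_snoc]
      exact ⟨p, hp, ha, hb⟩

end FirstOrder.Language.BoundedFormula

theorem realize_sentence_prod_iff {G H : Type*} [Group G] [Group H] (φ : groupLang.Sentence) :
    (G × H) ⊨ φ ↔ ∃ p ∈ BoundedFormula.prodPairs φ,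
      Sentence.Realize G p.1 ∧ Sentence.Realize H p.2 := by
  simp only [Sentence.Realize, Formula.Realize, BoundedFormula.realize_prod_iff φ]
  exact exists_congr fun p => and_congr_right fun _ => by
    rw [Subsingleton.elim (Prod.fst ∘ default) default,
      Subsingleton.elim (Prod.snd ∘ default) default,
      Subsingleton.elim (Prod.fst ∘ default) default,
      Subsingleton.elim (Prod.snd ∘ default) default]

/-- Elementary equivalence of groups is preserved by binary products. -/
theorem elementarilyEquivalent_prod {G H G' H' : Type*}
    [Group G] [Group H] [Group G'] [Group H'] (hG : G ≅[groupLang] G')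
    (hH : H ≅[groupLang] H') : (G × H) ≅[groupLang] (G' × H') :=
  elementarilyEquivalent_iff.2 fun φ => by
    simp only [realize_sentence_prod_iff]
    exact exists_congr fun p => and_congr_right fun _ =>
      and_congr (hG.realize_sentence p.1) (hH.realize_sentence p.2)

end ModelTheory

/-! ### Splitting of extensions with torsion-free quotient -/

section Splitting

/-- A sequence with `a k = (k + 1) • a (k + 1)` is the sequence of the images of `1 / k!` under a
homomorphism from `ℚ`. -/
theorem exists_addMonoidHom_rat {I : Type*} [AddCommGroup I] (a : ℕ → I)
    (ha : ∀ k, a k = (k + 1) • a (k + 1)) :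
    ∃ h : ℚ →+ I, ∀ (q : ℚ) (m : ℤ) (k : ℕ), q * k.factorial = m → h q = m • a k := by
  have step (k l : ℕ) (hkl : k ≤ l) (q : ℚ) (m m' : ℤ) (h : q * k.factorial = m)
      (h' : q * l.factorial = m') : m • a k = m' • a l := by
    induction l, hkl using Nat.le_induction generalizing m' with
    | base => rw [show m = m' by exact_mod_cast h.symm.trans h']
    | succ l hl ih =>
      obtain ⟨c, hc⟩ := Nat.factorial_dvd_factorial hl
      have h2 : q * l.factorial = (m * c : ℤ) := by
        rw [hc]; push_cast; rw [← h]; ring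
      rw [ih _ h2, ha l, ← natCast_zsmul, smul_smul]
      congr 1
      have : ((m * c * ((l + 1 : ℕ) : ℤ) : ℤ) : ℚ) = m' := by
        rw [← h', Int.cast_mul, ← h2, Nat.factorial_succ]; push_cast; ring
      exact_mod_cast this
  have ex (q : ℚ) : q * q.den.factorial = (q * q.den.factorial).num := by
    obtain ⟨c, hc⟩ := Nat.dvd_factorial q.den_pos le_rfl
    have : q * q.den.factorial = ((q.num * c : ℤ) : ℚ) := by
      rw [hc]; push_cast; rw [← mul_assoc, Rat.mul_den_eq_num]
    rw [this, Rat.num_intCast]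
  have key (q : ℚ) (m : ℤ) (k : ℕ) (h : q * k.factorial = m) :
      (q * q.den.factorial).num • a q.den = m • a k := by
    rcases le_total k q.den with hk | hk
    · exact (step _ _ hk q _ _ h (ex q)).symm
    · exact step _ _ hk q _ _ (ex q) h
  have int_of_le (q : ℚ) (k : ℕ) (hk : q.den ≤ k) : ∃ m : ℤ, q * k.factorial = m := by
    obtain ⟨c, hc⟩ := Nat.factorial_dvd_factorial hk
    refine ⟨(q * q.den.factorial).num * c, ?_⟩
    rw [hc]; push_cast; rw [← mul_assoc, ← ex q]
  refine ⟨AddMonoidHom.mk' (fun q => (q * q.den.factorial).num • a q.den) fun p q => ?_, key⟩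
  -- The factorial of `p.den + q.den` clears both denominators, so `p`, `q` and `p + q` are all
  -- evaluated on the same `a k`.
  obtain ⟨m, hm⟩ := int_of_le p (p.den + q.den) (by omega)
  obtain ⟨m', hm'⟩ := int_of_le q (p.den + q.den) (by omega)
  rw [key p m _ hm, key q m' _ hm', key (p + q) (m + m') (p.den + q.den), add_smul]
  push_cast
  rw [← hm, ← hm', add_mul]

/-- If every system of equations `z k = (k + 1) • z (k + 1) + c k` is solvable in the kernel of a
surjective homomorphism, then every homomorphism from `ℚ` lifts along it. -/
theorem exists_lift_rat {I Q : Type*} [AddCommGroup I] [AddCommGroup Q] (π : I →+ Q)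
    (hπ : Function.Surjective π)
    (hker : ∀ c : ℕ → π.ker, ∃ z : ℕ → π.ker, ∀ k, z k = (k + 1) • z (k + 1) + c k)
    (g : ℚ →+ Q) : ∃ h : ℚ →+ I, π.comp h = g := by
  have hg (k : ℕ) : g (1 / k.factorial) = (k + 1) • g (1 / (k + 1).factorial) := by
    rw [← map_nsmul]
    congr 1
    rw [Nat.factorial_succ, nsmul_eq_mul]
    push_cast
    field_simp
  choose a ha using fun k : ℕ => hπ (g (1 / k.factorial))
  -- Arbitrary lifts `a k` of `g (1 / k!)` satisfy the recursion up to an error in the kernel;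
  -- adding `z k` removes it.
  obtain ⟨z, hz⟩ := hker fun k => ⟨(k + 1) • a (k + 1) - a k, by
    rw [AddMonoidHom.mem_ker, map_sub, map_nsmul, ha, ha, ← hg, sub_self]⟩
  obtain ⟨h, hh⟩ := exists_addMonoidHom_rat (fun k => a k + z k) fun k => by
    rw [hz k, smul_add]
    push_cast
    abel
  refine ⟨h, ?_⟩
  ext q
  obtain ⟨c, hc⟩ := Nat.dvd_factorial q.den_pos le_rfl
  have e : q * q.den.factorial = ((q.num * c : ℤ) : ℚ) := by
    rw [hc]; push_cast; rw [← mul_assoc, Rat.mul_den_eq_num]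
  rw [AddMonoidHom.comp_apply, hh q _ _ e, map_zsmul, map_add, (z q.den).2, add_zero, ha,
    ← map_zsmul]
  congr 1
  rw [zsmul_eq_mul, ← e]
  field_simp

/-- If every homomorphism from `ℚ` lifts along a surjective homomorphism, so does every
homomorphism from a `ℚ`-vector space. -/
theorem exists_lift_of_module_rat {I Q V : Type*} [AddCommGroup I] [AddCommGroup Q]
    [AddCommGroup V] [Module ℚ V] (π : I →+ Q)
    (hπ : ∀ g : ℚ →+ Q, ∃ h : ℚ →+ I, π.comp h = g) (g : V →+ Q) :
    ∃ h : V →+ I, π.comp h = g := by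
  let b := Module.Basis.ofVectorSpace ℚ V
  choose h hh using fun i => hπ (g.comp (b.repr.symm.toLinearMap.toAddMonoidHom.comp
    (Finsupp.singleAddHom i)))
  refine ⟨(Finsupp.liftAddHom h).comp b.repr.toLinearMap.toAddMonoidHom, ?_⟩
  have : (π.comp (Finsupp.liftAddHom h)) = g.comp b.repr.symm.toLinearMap.toAddMonoidHom := by
    refine Finsupp.addHom_ext fun i q => ?_
    simpa using DFunLike.congr_fun (hh i) q
  ext x
  simpa using DFunLike.congr_fun this (b.repr x)

/-- An abelian group embeds into a divisible abelian group. -/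
theorem exists_injective_divisible (D : Type u) [AddCommGroup D] :
    ∃ (I : Type u) (_ : AddCommGroup I) (_ : DivisibleBy I ℤ) (e : D →+ I),
      Function.Injective e := by
  -- A power of `ℚ/ℤ` with one factor per character: characters separate points.
  refine ⟨CharacterModule D → AddCircle (1 : ℚ), inferInstance, inferInstance,
    AddMonoidHom.pi fun c => c, ?_⟩
  rw [injective_iff_map_eq_zero]
  intro x hx
  by_contra h
  obtain ⟨c, hc⟩ := CharacterModule.exists_character_apply_ne_zero_of_ne_zero h
  exact hc (congrFun hx c)

/-- An abelian group in which every system of equations `z k = (k + 1) • z (k + 1) + c k` is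
solvable is a direct summand of every abelian group in which it has a torsion-free quotient. -/
theorem exists_retraction_of_torsionFree_quotient {W D : Type*} [AddCommGroup W] [AddCommGroup D]
    (j : W →+ D) (hj : Function.Injective j)
    (hfree : ∀ (d : D) (n : ℕ), n ≠ 0 → n • d ∈ j.range → d ∈ j.range)
    (hW : ∀ c : ℕ → W, ∃ z : ℕ → W, ∀ k, z k = (k + 1) • z (k + 1) + c k) :
    ∃ ρ : D →+ W, ∀ w, ρ (j w) = w := by
  -- With `W ≅ N ⊆ I`, the plan is to lift the induced map `D / W → I / N` to a map into `I`. Its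
  -- difference from `e` then takes values in `N` and agrees with `e` on `W`.
  obtain ⟨I, _, _, e, he⟩ := exists_injective_divisible D
  let B := D ⧸ j.range
  let N : AddSubgroup I := (e.comp j).range
  have : IsAddTorsionFree B := by
    constructor
    intro n hn
    refine (injective_iff_map_eq_zero (nsmulAddMonoidHom n : B →+ B)).2 fun x hx => ?_
    induction x using QuotientAddGroup.induction_on with | H d => ?_
    rw [QuotientAddGroup.eq_zero_iff]
    exact hfree d n hn ((QuotientAddGroup.eq_zero_iff _).1 hx)
  let em : W ≃+ N := AddMonoidHom.ofInjective (f := e.comp j) (he.comp hj)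
  let π : I →+ I ⧸ N := QuotientAddGroup.mk' N
  have hker : π.ker = N := QuotientAddGroup.ker_mk' N
  have hlift (g : ℚ →+ I ⧸ N) : ∃ h : ℚ →+ I, π.comp h = g := by
    refine exists_lift_rat π (QuotientAddGroup.mk'_surjective N) ?_ g
    rw [hker]
    intro c
    obtain ⟨z, hz⟩ := hW fun k => em.symm (c k)
    refine ⟨fun k => em (z k), fun k => ?_⟩
    simp only [hz k, map_add, map_nsmul, AddEquiv.apply_symm_apply]
  let g₀ : B →+ I ⧸ N := QuotientAddGroup.map j.range N e (by
    rintro _ ⟨w, rfl⟩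
    exact ⟨w, rfl⟩)
  have : DivisibleBy (I ⧸ N) ℤ :=
    Function.Surjective.divisibleBy (π : I → I ⧸ N) (QuotientAddGroup.mk'_surjective N)
      fun a n => map_zsmul π n a
  -- The torsion-free `B` embeds in its divisible hull, a `ℚ`-vector space. Since `I ⧸ N` is
  -- divisible, hence injective, `g₀` extends to the hull, where lifting reduces to maps from `ℚ`.
  obtain ⟨g, hg⟩ := (Module.Baer.of_divisible (I ⧸ N)).extension_property_addMonoidHom
    (DivisibleHull.coeAddMonoidHom B) DivisibleHull.coe_injective g₀
  obtain ⟨h, hh⟩ := exists_lift_of_module_rat π hlift g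
  have hmem (d : D) : e d - h (DivisibleHull.coeAddMonoidHom B d) ∈ N := by
    rw [← hker, AddMonoidHom.mem_ker, map_sub, sub_eq_zero]
    have h1 := DFunLike.congr_fun hh (DivisibleHull.coeAddMonoidHom B d)
    have h2 := DFunLike.congr_fun hg (d : B)
    exact (h1.trans h2).symm
  refine ⟨em.symm.toAddMonoidHom.comp
    ((e - h.comp ((DivisibleHull.coeAddMonoidHom B).comp (QuotientAddGroup.mk' _))).codRestrict N
      hmem), fun w => ?_⟩
  refine em.symm_apply_eq.2 (Subtype.ext ?_)
  have h0 : ((j w : D) : B) = 0 := (QuotientAddGroup.eq_zero_iff _).2 ⟨w, rfl⟩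
  change e (j w) - h (DivisibleHull.coeAddMonoidHom B (j w : D)) = e (j w)
  rw [h0, map_zero, map_zero, sub_zero]

end Splitting

/-! ### Solving equations in ultrapowers -/

section Germs

open Filter

/-- The homomorphism of groups of germs induced by a homomorphism. -/
def Filter.Germ.mapHom {ι G H : Type*} [Group G] [Group H] (l : Filter ι) (f : G →* H) :
    Germ l G →* Germ l H :=
  MonoidHom.mk' (Germ.map f) fun x y => Germ.inductionOn₂ x y fun a b =>
    congrArg Germ.ofFun (funext fun i => map_mul f (a i) (b i))

@[simp]
theorem Filter.Germ.mapHom_coe {ι G H : Type*} [Group G] [Group H] (l : Filter ι) (f : G →* H)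
    (a : ι → G) : Germ.mapHom l f (a : Germ l G) = (fun i => f (a i) : ι → H) :=
  rfl

/-- In an ultrapower of an abelian group over a nonprincipal ultrafilter on `ℕ`, the equations
`z k = z (k + 1) ^ (k + 1) * c k` have a common solution. -/
theorem exists_germ_eq_pow_mul {W : Type*} [CommGroup W] {l : Filter ℕ} (hl : l ≤ atTop)
    (c : ℕ → Germ l W) : ∃ z : ℕ → Germ l W, ∀ k, z k = z (k + 1) ^ (k + 1) * c k := by
  -- Finitely many equations are solved backwards from any prescribed `z N`.
  have fin (a : ℕ → W) (N : ℕ) : ∀ y : W, ∃ z : ℕ → W, z N = y ∧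
      ∀ k < N, z k = z (k + 1) ^ (k + 1) * a k := by
    induction N with
    | zero => exact fun y => ⟨fun _ => y, rfl, by simp⟩
    | succ N ih =>
      intro y
      obtain ⟨z, hz, h⟩ := ih (y ^ (N + 1) * a N)
      refine ⟨Function.update z (N + 1) y, by simp, fun k hk => ?_⟩
      rw [Function.update_of_ne hk.ne]
      rcases Nat.lt_succ_iff_lt_or_eq.1 hk with hk' | rfl
      · rw [Function.update_of_ne (by omega), h k hk']
      · rw [Function.update_self, hz]
  choose c' hc' using fun k => Quotient.exists_rep (c k)
  -- Coordinate `i` solves only the first `i` equations; equation `k` thus holds for all `i > k`,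
  -- which is enough as `l ≤ atTop`.
  choose z _ hz using fun i => fin (fun k => c' k i) i 1
  refine ⟨fun k => (fun i => z i k : ℕ → W), fun k => ?_⟩
  rw [← hc' k]
  refine Germ.coe_eq.2 ?_
  filter_upwards [hl (eventually_gt_atTop k)] with i hi
  exact hz i k hi

/-- Passing to a nonprincipal ultrapower over `ℕ`, an extension of abelian groups with torsion-free
quotient splits. -/
theorem exists_germ_retraction {W D : Type*} [CommGroup W] [CommGroup D] {l : Filter ℕ}
    (hl : l ≤ atTop) (j : W →* D) (hj : Function.Injective j)
    (hfree : ∀ (d : D) (n : ℕ), n ≠ 0 → d ^ n ∈ j.range → d ∈ j.range) :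
    ∃ ρ : Germ l D →* Germ l W, ∀ w, ρ (Germ.mapHom l j w) = w := by
  suffices h : _ ∧ _ by
    obtain ⟨ρ, hρ⟩ := exists_retraction_of_torsionFree_quotient
      (MonoidHom.toAdditive (Germ.mapHom l j)) h.1 h.2
      (fun c => exists_germ_eq_pow_mul (W := W) hl c)
    exact ⟨MonoidHom.toAdditive.symm ρ, hρ⟩
  constructor
  · refine (injective_iff_map_eq_one (Germ.mapHom l j)).2 fun x => Germ.inductionOn x fun a h => ?_
    refine Germ.coe_eq.2 ((Germ.coe_eq.1 h).mono fun i hi => ?_)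
    exact (map_eq_one_iff j hj).1 hi
  · intro (d : Germ l D) n hn
    induction d using Germ.inductionOn with | h a => ?_
    rintro ⟨w, hw⟩
    change Germ l W at w
    induction w using Germ.inductionOn with | h w => ?_
    have h1 : (fun i => j (w i)) =ᶠ[l] a ^ n := Germ.coe_eq.1 hw
    -- Roots are taken index by index; `1` is a dummy value where `a i` is outside the range.
    have h2 : ∀ i, ∃ w', a i ^ n ∈ j.range → j w' = a i := fun i => by
      by_cases h : a i ∈ j.range
      · obtain ⟨w', h'⟩ := h
        exact ⟨w', fun _ => h'⟩
      · exact ⟨1, fun h' => absurd (hfree _ n hn h') h⟩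
    choose w' hw' using h2
    refine ⟨(w' : Germ l W), Germ.coe_eq.2 (h1.mono fun i hi => hw' i ⟨w i, hi⟩)⟩

end Germs

/-! ### Cocycles that are CoT and their extensions -/

section Extensions

open Filter

variable {A : Type u} {Z : Type v} [CommGroup A] [CommGroup Z]

/-- The embedding of `Z` into its extension by `A`. -/
def AbExt.incl (f : symmCocycles A Z) : Z →* AbExt f where
  toFun z := ⟨z, 1⟩
  map_one' := rfl
  map_mul' x y := by
    ext
    · simp [(f.2.2.1 1).1]
    · simp

theorem AbExt.exists_incl_eq {f : symmCocycles A Z} {d : AbExt f} (h : d.b = 1) :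
    d = AbExt.incl f d.z :=
  AbExt.ext rfl h

/-- The extension given by a cocycle that is CoT splits over the torsion subgroup. -/
theorem IsCoT.exists_section {f : symmCocycles A Z} (hf : IsCoT f) :
    ∃ σ : CommGroup.torsion A →* AbExt f, ∀ t, (σ t).b = t := by
  obtain ⟨B, -, f₁, f₂, g, hg, ⟨ψ, hψ⟩, ψ₁, hψ₁⟩ := hf
  -- On torsion `g` restricts to `f₁`, so `ψ * ψ₁` trivialises `f` there.
  refine ⟨MonoidHom.mk' (fun t => ⟨ψ t * ψ₁ t, t⟩) fun t t' => ?_, fun t => rfl⟩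
  have h1 : g.1 t t' = f₁.1 t t' := by
    have := hg t t' 1 1
    simpa [(f₂.2.2.1 1).1] using this
  ext
  · have h2 := hψ t t'
    simp only [Pi.mul_apply, Pi.inv_apply, h1] at h2
    simp only [AbExt.mul_z, Subgroup.coe_mul, hψ₁, h2]
    rw [show f.1 t t' * (f₁.1 t t')⁻¹ * ψ t * ψ t' * (f₁.1 t t' * ψ₁ t * ψ₁ t') =
      (f₁.1 t t')⁻¹ * f₁.1 t t' * (ψ t * ψ₁ t * (ψ t' * ψ₁ t') * f.1 t t') by ac_rfl,
      inv_mul_cancel, one_mul]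
  · simp

/-- The extension given by a cocycle that is CoT splits in a nonprincipal ultrapower over `ℕ`. -/
theorem IsCoT.exists_germ_retraction {f : symmCocycles A Z} (hf : IsCoT f) {l : Filter ℕ}
    (hl : l ≤ atTop) :
    ∃ ρ : Germ l (AbExt f) →* Germ l Z, ∀ w, ρ (Germ.mapHom l (AbExt.incl f) w) = w := by
  obtain ⟨σ, hσ⟩ := hf.exists_section
  -- The quotient by `Z` alone is `A`, which may have torsion. The range of `j` is the preimage of
  -- the torsion subgroup, so its quotient is torsion-free.
  let j : Z × CommGroup.torsion A →* AbExt f := (AbExt.incl f).coprod σ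
  have hjb (w) : (j w).b = w.2 := by simp [j, hσ, AbExt.incl]
  have hmem (d : AbExt f) : d ∈ j.range ↔ d.b ∈ CommGroup.torsion A := by
    constructor
    · rintro ⟨w, rfl⟩
      exact hjb w ▸ w.2.2
    · intro h
      refine ⟨((d * (σ ⟨_, h⟩)⁻¹).z, ⟨_, h⟩), ?_⟩
      rw [MonoidHom.coprod_apply, ← AbExt.exists_incl_eq (by simp [hσ]), inv_mul_cancel_right]
  suffices h : _ ∧ _ by
    obtain ⟨ρ, hρ⟩ := _root_.exists_germ_retraction hl j h.1 h.2
    refine ⟨(Germ.mapHom l (MonoidHom.fst _ _)).comp ρ, fun w => ?_⟩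
    have h1 : Germ.mapHom l (AbExt.incl f) w = Germ.mapHom l j
        (Germ.mapHom l (MonoidHom.inl Z (CommGroup.torsion A)) w) := by
      induction w using Germ.inductionOn with | h w => ?_
      simp [j]
    rw [h1, MonoidHom.comp_apply, hρ]
    exact Germ.inductionOn w fun w => rfl
  constructor
  · refine (injective_iff_map_eq_one j).2 fun w hw => ?_
    have h2 : w.2 = 1 := Subtype.ext (by rw [← hjb, hw]; rfl)
    refine Prod.ext ?_ h2
    have := congrArg AbExt.z hw
    simpa [j, h2, AbExt.incl] using this
  · intro d n hn h
    rw [hmem] at h ⊢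
    have h' : (d ^ n).b = d.b ^ n := map_pow (AbExt.proj f) d n
    rw [h'] at h
    obtain ⟨m, hm, h⟩ := isOfFinOrder_iff_pow_eq_one.1 h
    exact isOfFinOrder_iff_pow_eq_one.2
      ⟨n * m, Nat.mul_pos (Nat.pos_of_ne_zero hn) hm, by rw [pow_mul, h]⟩

/-- A semidirect product with an extension given by a cocycle that is CoT is elementarily
equivalent to the one with the split extension. -/
theorem IsCoT.semidirectProduct_elementarilyEquivalent {N : Type*} [Group N]
    {f : symmCocycles A Z} (hf : IsCoT f) (φ : A →* MulAut N) :
    (N ⋊[φ.comp (AbExt.proj f)] AbExt f) ≅[groupLang] ((N ⋊[φ] A) × Z) := by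
  let U : Ultrafilter ℕ := hyperfilter ℕ
  have hl : (U : Filter ℕ) ≤ atTop := Nat.hyperfilter_le_atTop
  obtain ⟨ρ, hρ⟩ := hf.exists_germ_retraction hl
  let q : (N ⋊[φ.comp (AbExt.proj f)] AbExt f) →* N ⋊[φ] A :=
    SemidirectProduct.map (MonoidHom.id N) (AbExt.proj f) fun _ => rfl
  let r : (N ⋊[φ.comp (AbExt.proj f)] AbExt f) →* AbExt f := SemidirectProduct.rightHom
  let s : Z →* N ⋊[φ.comp (AbExt.proj f)] AbExt f := SemidirectProduct.inr.comp (AbExt.incl f)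
  -- Bijective because the first component is onto and its kernel is the ultrapower of `Z`, which
  -- the second component maps identically.
  let Φ := (Germ.mapHom (U : Filter ℕ) q).prod (ρ.comp (Germ.mapHom (U : Filter ℕ) r))
  have hs (w) : Φ (Germ.mapHom (U : Filter ℕ) s w) = (1, w) := by
    refine Prod.ext ?_ ?_
    · induction w using Germ.inductionOn with | h w => ?_
      exact congrArg Germ.ofFun (funext fun i => SemidirectProduct.ext rfl rfl)
    · refine Eq.trans (congrArg ρ ?_) (hρ w)
      exact Germ.inductionOn w fun w => rfl
  have hker (x) (h : q x = 1) : x = s x.right.z := by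
    refine SemidirectProduct.ext (congrArg (fun y => y.left) h) ?_
    exact AbExt.exists_incl_eq (congrArg (fun y => y.right) h)
  have hbij : Function.Bijective Φ := by
    constructor
    · refine (injective_iff_map_eq_one Φ).2 fun x hx => ?_
      obtain ⟨w, rfl⟩ : ∃ w, Germ.mapHom (U : Filter ℕ) s w = x := by
        induction x using Germ.inductionOn with | h x => ?_
        have h1 : Germ.mapHom (U : Filter ℕ) q x = 1 := congrArg Prod.fst hx
        refine ⟨(fun i => (x i).right.z : ℕ → Z), Germ.coe_eq.2 ?_⟩
        exact (Germ.coe_eq.1 h1).mono fun i hi => (hker _ hi).symm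
      rw [hs] at hx
      rw [show w = 1 from congrArg Prod.snd hx, map_one]
    · rintro ⟨t, w⟩
      obtain ⟨x, hx⟩ : ∃ x, Germ.mapHom (U : Filter ℕ) q x = t := by
        induction t using Germ.inductionOn with | h t => ?_
        exact ⟨((fun i => ⟨(t i).left, ⟨1, (t i).right⟩⟩ :
          ℕ → N ⋊[φ.comp (AbExt.proj f)] AbExt f) : Germ (U : Filter ℕ) _), rfl⟩
      refine ⟨x * Germ.mapHom (U : Filter ℕ) s ((Φ x).2⁻¹ * w), ?_⟩
      rw [map_mul, hs]
      refine Prod.ext ?_ ?_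
      · exact (mul_one _).trans hx
      · exact mul_inv_cancel_left _ _
  have e := MulEquiv.ofBijective Φ hbij
  exact ((elementarilyEquivalent_germ _ U).trans e.elementarilyEquivalent).trans
    (elementarilyEquivalent_prod (elementarilyEquivalent_germ _ U).symm
      (elementarilyEquivalent_germ _ U).symm)

end Extensions

/-! ### Splitting the scalars off `Tₙ(F)` -/

section Triangular

variable (n : ℕ) (F : Type u) [Field F]

@[simp]
theorem diagEntries_diagHom (d : Fin n → Fˣ) (i : Fin n) :
    diagEntries n F (diagHom n F d) i = d i :=
  Matrix.diagonal_apply_eq _ i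

theorem triGroup_apply_self_ne_zero (g : triGroup n F) (i : Fin n) : diagEntries n F g i ≠ 0 := by
  have h := congrFun ((map_mul (diagEntries n F) g g⁻¹).symm.trans
    (by rw [mul_inv_cancel, map_one])) i
  exact left_ne_zero_of_mul (h.trans_ne one_ne_zero)

theorem diagHom_const_comm (c : Fˣ) (g : triGroup n F) :
    Commute g (diagHom n F fun _ => c) := by
  refine Subtype.ext (Units.ext ?_)
  have : ((diagHom n F fun _ => c : triGroup n F) : GL (Fin n) F).1 =
    (Matrix.diagonal fun _ => (c : F)) := rfl
  simp only [Subgroup.coe_mul, Units.val_mul, this]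
  exact (Matrix.scalar_commute (c : F) (fun r => mul_comm _ _) _).symm

/-- `T_n(F)` is the direct product of `UT_n(F) ⋊ B_n(F)` and the group of scalar matrices. -/
theorem exists_triGroup_mulEquiv (hn : 1 ≤ n) :
    Nonempty ((uniTri n F ⋊[torusAct n F] torusB n F) × Fˣ ≃* triGroup n F) := by
  let p : uniTri n F ⋊[torusAct n F] torusB n F →* triGroup n F :=
    SemidirectProduct.lift (uniTri n F).subtype ((diagHom n F).comp (torusB n F).subtype)
      fun b => rfl
  let s : Fˣ →* triGroup n F := (diagHom n F).comp (Pi.constMonoidHom (Fin n) Fˣ)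
  let Φ := p.noncommCoprod s fun x c => diagHom_const_comm n F c (p x)
  have hΦ (x) : Φ x = x.1.left.1 * diagHom n F x.1.right.1 * diagHom n F fun _ => x.2 := rfl
  have hdiag (x i) : diagEntries n F (Φ x) i = x.1.right.1 i * x.2 := by
    have h1 : diagEntries n F x.1.left.1 = 1 := x.1.left.2
    simp [hΦ, h1]
  -- Elements of `Bₙ` and `UTₙ` have last diagonal entry `1`, so this entry of a product is its
  -- scalar factor.
  let last : Fin n := ⟨n - 1, by omega⟩
  have hlast (i : Fin n) (hi : (i : ℕ) + 1 = n) : i = last := Fin.ext (by simp [last]; omega)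
  refine ⟨MulEquiv.ofBijective Φ ⟨?_, ?_⟩⟩
  · refine (injective_iff_map_eq_one Φ).2 fun x hx => ?_
    have hd (i) : (x.1.right.1 i : F) * x.2 = 1 := by
      rw [← hdiag, hx, map_one]; rfl
    have h2 : x.2 = 1 := by
      have := hd last
      rw [x.1.right.2 last (by simp [last]; omega)] at this
      exact Units.ext (by simpa using this)
    have hr : x.1.right = 1 := Subtype.ext (funext fun i => Units.ext (by simpa [h2] using hd i))
    have hl : x.1.left = 1 := by
      refine Subtype.ext ?_
      have h3 := hΦ x
      rw [hx, hr, h2] at h3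
      simpa [← Pi.one_def] using h3.symm
    exact Prod.ext (SemidirectProduct.ext hl hr) h2
  · intro g
    let d : Fin n → Fˣ := fun i => Units.mk0 _ (triGroup_apply_self_ne_zero n F g i)
    let b : torusB n F := ⟨fun i => d i * (d last)⁻¹, fun i hi => by
      rw [hlast i hi]; exact mul_inv_cancel _⟩
    have hb : diagHom n F b.1 * diagHom n F (fun _ => d last) = diagHom n F d := by
      rw [← map_mul]
      exact congrArg _ (funext fun i => inv_mul_cancel_right _ _)
    refine ⟨(⟨⟨g * (diagHom n F d)⁻¹, ?_⟩, b⟩, d last), ?_⟩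
    · rw [uniTri, MonoidHom.mem_ker, ← map_inv, map_mul]
      funext i
      simp [d, triGroup_apply_self_ne_zero]
    · rw [hΦ, mul_assoc, hb, inv_mul_cancel_right]

end Triangular

theorem mainTheorem6 {F : Type u} [Field F] (hF : IsNFTField F)
    {Z : Type v} [CommGroup Z] (hZ : Z ≅[groupLang] Fˣ)
    (n : ℕ) (hn : 1 ≤ n) (f : symmCocycles (torusB n F) Z) (hf : IsCoT f) :
    AbDeformation n F Z f ≅[groupLang] triGroup n F := by
  obtain ⟨e⟩ := exists_triGroup_mulEquiv n F hn
  exact ((hf.semidirectProduct_elementarilyEquivalent (torusAct n F)).trans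
    (elementarilyEquivalent_prod rfl hZ)).trans e.elementarilyEquivalent
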